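/- **Theorem (volume-optimality of pullback balls under radiality).** Let $d\ge 1$, let $(Y,X)$ be a random vector with values in $\mathbb{R}^{d}\times\mathbb{R}^{d_x}$, let $F_{Y\mid X=x}$ be (a version of) the conditional law of $Y$ given $X=x$, and write $\mathbb{P}\{Y\in A\mid X=x\}=F_{Y\mid X=x}(A)$. Fix $x$ in the support of the law of $X$, suppose that $F_{Y\mid X=x}$ is absolutely continuous with respect to Lebesgue measure, and let $\mathcal{Y}_x$ be its (closed) support. Let $\mu$ be a probability measure on $\mathbb{R}^d$ (the reference law) whose support $\mathcal{U}$ is convex and which has the Lebesgue density $f_U(u)=\phi(\|u\|)$ on $\mathcal{U}$ and $0$ outside $\mathcal U$, where $\phi:[0,\infty)\to(0,\infty)$ is measurable (for instance strictly decreasing, or continuous) and $\|\cdot\|$ is the Euclidean norm. Let $Q_{Y\mid X}(\cdot,x)$ be a vector quantile function, i.e. a measurable map which is $\mu$-a.e. the gradient of a convex function and which pushes $\mu$ forward to $F_{Y\mid X=x}$. Let $Q^{-1}_{Y\mid X}(\cdot,x):\mathcal{Y}_x\to\mathcal{U}$ be a rank function, i.e. a measurable map with $Q^{-1}_{Y\mid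 X}(Q_{Y\mid X}(u,x),x)=u$ for $\mu$-a.e. $u$. Assume that there is a function $j_x:[0,\infty)\to\mathbb{R}$ such that for all $y\in\mathcal{Y}_x$ the map $Q^{-1}_{Y\mid X}(\cdot,x)$ is differentiable at $y$ relative to $\mathcal{Y}_x$, with $$\det\bigl[\nabla_y Q^{-1}_{Y\mid X}(y,x)\bigr]=j_x\bigl(\|Q^{-1}_{Y\mid X}(y,x)\|\bigr),$$ and that $r\mapsto\phi(r)\,j_x(r)$ is strictly decreasing on the set of radii $\{\|u\|:u\in\mathcal{U}\}$. Here, at a boundary point of $\mathcal Y_x$ where the relative derivative is not unique, it is enough that one relative derivative satisfies the identity. Let $\alpha\in(0,1)$ and $B_r=\{u:\|u\|\le r\}$. Then there is a unique $r_\alpha>0$ with $\mu(B_{r_\alpha})=1-\alpha$, and the pullback ball $$\mathcal{C}^{\mathrm{pb}}_\alpha(x)=\{y\in\mathcal{Y}_x:\|Q^{-1}_{Y\mid X}(y,x)\|\le r_\alpha\}$$ is a Borel set with the following properties. 1. $\mathbb{P}\{Y\in\mathcal{C}^{\mathrm{pb}}_\alpha(x)\mid X=x\}=1-\alpha$. 2.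 For every measurable $A\subseteq\mathbb{R}^d$ with $\mathbb{P}\{Y\in A\mid X=x\}\ge 1-\alpha$ one has $\operatorname{Vol}(\mathcal{C}^{\mathrm{pb}}_\alpha(x))\le\operatorname{Vol}(A)$, where $\operatorname{Vol}$ is Lebesgue measure. 3. $\mathcal{C}^{\mathrm{pb}}_\alpha(x)$ is the highest probability density (HPD) region of $Y\mid X=x$ at level $1-\alpha$: for every density $f$ of $F_{Y\mid X=x}$ there is a largest $t$ with $\mathbb{P}\{f(Y)\ge t\mid X=x\}\ge 1-\alpha$, and $\mathcal{C}^{\mathrm{pb}}_\alpha(x)=\{y:f(y)\ge t\}$ up to a Lebesgue null set. -/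

import Mathlib

open MeasureTheory ProbabilityTheory Set
open scoped NNReal ENNReal

/-- The reference law `μ` has density `u ↦ φ (‖u‖)` on its support (and zero outside it),
with respect to Lebesgue measure, where `φ : [0, ∞) → (0, ∞)`, and its support is convex. -/
structure IsRadialReference {d : ℕ} (μ : Measure (EuclideanSpace ℝ (Fin d)))
    (φ : ℝ≥0 → ℝ) : Prop where
  measurable : Measurable φ
  pos : ∀ r, 0 < φ r
  eq_withDensity :
    μ = (volume.restrict μ.support).withDensity (fun u => ENNReal.ofReal (φ ‖u‖₊))
  convex_support : Convex ℝ μ.support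

/-- `Q` is a vector quantile of the law `ν` with respect to the reference law `μ`: a measurable
map which is (`μ`-almost everywhere) the gradient of a convex function and which pushes `μ`
forward to `ν`. The convex potential only has to be finite on the interior of the convex support
of `μ`. -/
structure IsVectorQuantile {d : ℕ} (μ ν : Measure (EuclideanSpace ℝ (Fin d)))
    (Q : EuclideanSpace ℝ (Fin d) → EuclideanSpace ℝ (Fin d)) : Prop where
  measurable : Measurable Q
  gradient_convex : ∃ Φ : EuclideanSpace ℝ (Fin d) → ℝ,
    ConvexOn ℝ (interior μ.support) Φ ∧ ∀ᵐ u ∂μ, HasGradientAt Φ (Q u) u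
  map_eq : μ.map Q = ν

/-- `R` is the multivariate rank map (inverse of the vector quantile `Q`): a measurable map from
the support of `ν` to the support of `μ` with `R (Q u) = u` for `μ`-almost every `u`. (If `Q`
pushes `μ` to `ν`, then `R` pushes `ν` to `μ` automatically.) The values of `R` outside the
support of `ν` are irrelevant. -/
structure IsVectorRank {d : ℕ} (μ ν : Measure (EuclideanSpace ℝ (Fin d)))
    (Q R : EuclideanSpace ℝ (Fin d) → EuclideanSpace ℝ (Fin d)) : Prop where
  measurable : Measurable R
  mapsTo : MapsTo R ν.support μ.support
  left_inv : ∀ᵐ u ∂μ, R (Q u) = u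

/-- At every point `y` of the support of `ν`, the map `R` is differentiable (relative to the
support) and its Jacobian determinant equals `j (‖R y‖)`. -/
def HasRadialJacobian {d : ℕ} (ν : Measure (EuclideanSpace ℝ (Fin d)))
    (R : EuclideanSpace ℝ (Fin d) → EuclideanSpace ℝ (Fin d)) (j : ℝ≥0 → ℝ) : Prop :=
  ∀ y ∈ ν.support, ∃ D : EuclideanSpace ℝ (Fin d) →L[ℝ] EuclideanSpace ℝ (Fin d),
    HasFDerivWithinAt R D ν.support y ∧ D.det = j ‖R y‖₊

/-- The pullback ball `{y : ‖R y‖ ≤ r}`, where `y` ranges over the support of `ν`, the domain of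
the rank map `R`. -/
def pullbackBall {d : ℕ} (ν : Measure (EuclideanSpace ℝ (Fin d)))
    (R : EuclideanSpace ℝ (Fin d) → EuclideanSpace ℝ (Fin d)) (r : ℝ) :
    Set (EuclideanSpace ℝ (Fin d)) :=
  {y | y ∈ ν.support ∧ ‖R y‖ ≤ r}

/-- `C` is the highest probability density region of level `β` of the law `ν`: `ν` has a
Lebesgue density and, for every version `f` of it, `C` agrees up to a Lebesgue null set with
`{y : f y ≥ t}`, where `t` is the largest threshold for which this superlevel set has
`ν`-probability at least `β`. -/
def IsHPDRegion {d : ℕ} (ν : Measure (EuclideanSpace ℝ (Fin d))) (β : ℝ)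
    (C : Set (EuclideanSpace ℝ (Fin d))) : Prop :=
  ν ≪ volume ∧
  ∀ f : EuclideanSpace ℝ (Fin d) → ℝ≥0∞, Measurable f → ν = volume.withDensity f →
    ∃ t : ℝ≥0∞, IsGreatest {s : ℝ≥0∞ | ENNReal.ofReal β ≤ ν {y | s ≤ f y}} t ∧
      C =ᵐ[volume] {y | t ≤ f y}

/-!
Write `ν` for the conditional law, `K` for its support, and `g y = φ (‖R y‖) * j (‖R y‖)` on `K`,
`g = 0` off `K`. The heart of the matter is that `g` is a Lebesgue density of `ν`. The radial
function `φ * j` being strictly decreasing, the pullback ball of radius `r` is then exactly the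
superlevel set `{g ≥ φ r * j r}`, and a superlevel set of a density has the least volume for its
mass (Neyman–Pearson, `measure_superlevel_le_of_withDensity_le`) and is a highest density region
(`exists_isGreatest_superlevel_ae_eq`).

That `g` is a density (`HasRadialJacobian.eq_withDensity`) is the change of variables formula for
`R`, but two points need care: the determinant could be negative, and `K` could contain a set of
positive Lebesgue measure which `ν` does not charge, whereas the pullback ball is taken in all of
`K`. Both are settled by monotonicity. `Q` is the gradient of a convex function, so its inverse
`R` is a monotone map on a dense subset of `K`, and by continuity on all of `K`
(`HasRadialJacobian.monotone`). At a Lebesgue density point of `K` all directions are tangent to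
`K`, so the derivative of `R` there is positive semidefinite and has nonnegative determinant
(`ContinuousLinearMap.det_nonneg_of_inner_nonneg`). If moreover the determinant does not vanish at
`y`, then `R` takes the value `R y` nowhere else in `K` (`eq_of_hasFDerivWithinAt_of_monotone`).
Since almost every point of the support of `μ` is the image of a point where `R` inverts `Q`, the
remaining points with nonzero Jacobian are mapped into a null set and so form a null set. Finally,
`φ * j` vanishes for at most one radius, and spheres are null.

The radius exists because spheres are null, and it is unique because the norms of the points of
the convex support form an interval.
-/

/-! ### Tangent directions and monotone maps -/

section
open Filter Topology Metric

/-- Near a density point `x`, the set `s` meets every small rescaled copy `x + r • closedBall v ε`,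
so that `v` is a limit of rescaled displacements within `s`. -/
theorem posTangentConeAt_eq_univ_of_density_one {E : Type*} [NormedAddCommGroup E]
    [NormedSpace ℝ E] [MeasurableSpace E] [BorelSpace E] [FiniteDimensional ℝ E]
    (μ : Measure E) [μ.IsAddHaarMeasure] {s : Set E} {x : E}
    (h : Tendsto (fun r => μ (s ∩ closedBall x r) / μ (closedBall x r)) (𝓝[>] 0) (𝓝 1)) :
    posTangentConeAt s x = univ := by
  refine eq_univ_of_forall fun v => ?_
  have key : ∀ n : ℕ, ∃ r : ℝ, (0 < r ∧ r < 1 / ((n : ℝ) + 1)) ∧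
      ∃ w ∈ closedBall v (1 / ((n : ℝ) + 1)), x + r • w ∈ s := by
    intro n
    have hn : (0 : ℝ) < 1 / ((n : ℝ) + 1) := by positivity
    have h1 := Measure.eventually_nonempty_inter_smul_of_density_one μ s x h
      (closedBall v (1 / ((n : ℝ) + 1))) measurableSet_closedBall
      (measure_closedBall_pos μ v hn).ne'
    have h2 : ∀ᶠ r : ℝ in 𝓝[>] 0, 0 < r ∧ r < 1 / ((n : ℝ) + 1) := Ioo_mem_nhdsGT hn
    obtain ⟨r, ⟨z, hzs, hz⟩, hr⟩ := (h1.and h2).exists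
    obtain ⟨_, rfl, _, ⟨w, hw, rfl⟩, rfl⟩ := hz
    exact ⟨r, hr, w, hw, hzs⟩
  choose r hr w hw hs using key
  have hlim : Tendsto (fun n : ℕ => 1 / ((n : ℝ) + 1)) atTop (𝓝 0) :=
    tendsto_one_div_add_atTop_nhds_zero_nat
  have hr0 : Tendsto r atTop (𝓝 0) :=
    squeeze_zero (fun n => (hr n).1.le) (fun n => (hr n).2.le) hlim
  have hwv : Tendsto w atTop (𝓝 v) :=
    tendsto_iff_dist_tendsto_zero.2 (squeeze_zero (fun _ => dist_nonneg) (fun n => hw n) hlim)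
  refine mem_tangentConeAt_of_seq atTop (fun n => (r n)⁻¹.toNNReal) (fun n => r n • w n)
    (by simpa using hr0.smul hwv) (Eventually.of_forall hs) ?_
  refine hwv.congr fun n => ?_
  have := (hr n).1
  rw [NNReal.smul_def, Real.coe_toNNReal _ (by positivity), inv_smul_smul₀ this.ne']

variable {E : Type*} [NormedAddCommGroup E] [InnerProductSpace ℝ E]

/-- A positive semidefinite (possibly not symmetric) operator is joined to the identity by a segment
of operators which are invertible except perhaps at the end `D`, so the determinant does not
change sign along it. -/
theorem ContinuousLinearMap.det_nonneg_of_inner_nonneg [FiniteDimensional ℝ E] (D : E →L[ℝ] E)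
    (hD : ∀ v, 0 ≤ inner ℝ (D v) v) : 0 ≤ D.det := by
  -- The homotopy `s • D + (1 - s) • id` from the identity to `D`.
  let F : ℝ → E →L[ℝ] E := fun s => s • D + (1 - s) • ContinuousLinearMap.id ℝ E
  have hF : Continuous fun s => (F s).det :=
    ContinuousLinearMap.continuous_det.comp (by fun_prop)
  have hne : ∀ s ∈ Ico (0 : ℝ) 1, (F s).det ≠ 0 := by
    intro s hs h0
    obtain ⟨v, hv, hv0⟩ := SetLike.exists_of_lt
      (LinearMap.bot_lt_ker_of_det_eq_zero (f := (F s : E →ₗ[ℝ] E)) h0)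
    have h1 : F s v = 0 := hv
    have h2 : inner ℝ (F s v) v = s * inner ℝ (D v) v + (1 - s) * ‖v‖ ^ 2 := by
      simp [F, inner_add_left, inner_smul_left]
    rw [h1, inner_zero_left] at h2
    have h3 : 0 < (1 - s) * ‖v‖ ^ 2 :=
      mul_pos (by linarith [hs.2]) (pow_pos (norm_pos_iff.2 (by simpa using hv0)) 2)
    nlinarith [mul_nonneg hs.1 (hD v)]
  by_contra! hneg
  have hF1 : (F 1).det < 0 := by simpa [F] using hneg
  have hF0 : (F 0).det = 1 := by simp [F, ContinuousLinearMap.det]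
  obtain ⟨s, hs, h0⟩ := intermediate_value_Icc' (zero_le_one' ℝ) hF.continuousOn
    (show (0 : ℝ) ∈ Icc (F 1).det (F 0).det from ⟨hF1.le, by rw [hF0]; norm_num⟩)
  rcases hs.2.lt_or_eq with h | rfl
  · exact hne s ⟨hs.1, h⟩ h0
  · exact hF1.ne h0

/-- Only differentiability at the two points is needed: each gradient is compared with the slope of
the chord between them. -/
theorem ConvexOn.inner_gradient_sub_nonneg [CompleteSpace E] {s : Set E} {Φ : E → ℝ}
    (hΦ : ConvexOn ℝ s Φ) {u v g h : E} (hu : u ∈ s) (hv : v ∈ s)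
    (hg : HasGradientAt Φ g u) (hh : HasGradientAt Φ h v) : 0 ≤ inner ℝ (g - h) (u - v) := by
  have key : ∀ {u v g : E}, u ∈ s → v ∈ s → HasGradientAt Φ g u →
      Φ u + inner ℝ g (v - u) ≤ Φ v := by
    intro u v g hu hv hg
    have hline : HasDerivAt (fun t : ℝ => Φ (AffineMap.lineMap u v t)) (inner ℝ g (v - u)) 0 := by
      have h1 : HasFDerivAt Φ (InnerProductSpace.toDual ℝ E g) (AffineMap.lineMap u v (0 : ℝ)) := by
        simpa using hg.hasFDerivAt
      simpa [Function.comp_def] using h1.comp_hasDerivAt (0 : ℝ) AffineMap.hasDerivAt_lineMap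
    have hconv : ConvexOn ℝ (Icc (0 : ℝ) 1) (fun t : ℝ => Φ (AffineMap.lineMap u v t)) := by
      refine (hΦ.comp_affineMap (AffineMap.lineMap u v)).subset (fun t ht => ?_) (convex_Icc 0 1)
      exact hΦ.1.lineMap_mem hu hv ht
    have := hconv.le_slope_of_hasDerivAt (x := 0) (y := 1) (by simp) (by simp) one_pos hline
    simp [slope_def_field] at this
    linarith
  have h1 := key hu hv hg
  have h2 := key hv hu hh
  have h3 : inner ℝ g (v - u) = -inner ℝ g (u - v) := by rw [← inner_neg_right, neg_sub]
  rw [inner_sub_left]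
  linarith

variable {R : E → E} {K : Set E} {D : E →L[ℝ] E} {y : E}

theorem inner_nonneg_of_hasFDerivWithinAt_of_monotone (hD : HasFDerivWithinAt R D K y)
    (hy : y ∈ K) (hK : posTangentConeAt K y = univ)
    (hmono : ∀ z ∈ K, ∀ w ∈ K, 0 ≤ inner ℝ (R z - R w) (z - w)) (v : E) :
    0 ≤ inner ℝ (D v) v := by
  obtain ⟨ι, l, hl, c, d, hd0, hd, hcd⟩ :=
    exists_fun_of_mem_tangentConeAt (hK.symm ▸ mem_univ v : v ∈ posTangentConeAt K y)
  simp only [NNReal.smul_def] at hcd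
  refine ge_of_tendsto ((hD.lim hd0 hd hcd).inner hcd) (hd.mono fun n hn => ?_)
  have := hmono _ hn _ hy
  rw [add_sub_cancel_left] at this
  rw [real_inner_smul_left, real_inner_smul_right]
  positivity

/-- A monotone map takes the value `R y` only at `y` if it has an invertible derivative at `y` and
every direction is tangent to the domain there. -/
theorem eq_of_hasFDerivWithinAt_of_monotone [FiniteDimensional ℝ E]
    (hD : HasFDerivWithinAt R D K y) (hK : posTangentConeAt K y = univ)
    (hmono : ∀ z ∈ K, ∀ w ∈ K, 0 ≤ inner ℝ (R z - R w) (z - w)) (hdet : D.det ≠ 0)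
    {w : E} (hw : w ∈ K) (hR : R w = R y) : w = y := by
  have key : ∀ v, 0 ≤ inner ℝ (D v) (y - w) := by
    intro v
    obtain ⟨ι, l, hl, c, d, hd0, hd, hcd⟩ :=
      exists_fun_of_mem_tangentConeAt (hK.symm ▸ mem_univ v : v ∈ posTangentConeAt K y)
    simp only [NNReal.smul_def] at hcd
    have hlim : Tendsto (fun n => y + d n - w) l (𝓝 (y - w)) := by
      simpa using (hd0.const_add y).sub_const w
    refine ge_of_tendsto ((hD.lim hd0 hd hcd).inner hlim) (hd.mono fun n hn => ?_)
    have := hmono _ hn _ hw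
    rw [hR] at this
    rw [real_inner_smul_left]
    positivity
  obtain ⟨v, hv⟩ : ∃ v, D v = w - y :=
    ((Module.End.isUnit_iff (D : E →ₗ[ℝ] E)).1
      ((LinearMap.isUnit_iff_isUnit_det _).2 (isUnit_iff_ne_zero.2 hdet))).2 _
  -- The direction that `D` sends to `w - y` makes the inner product equal to `-‖y - w‖ ^ 2`.
  have h1 := key v
  rw [hv, ← neg_sub y w, inner_neg_left, real_inner_self_eq_norm_sq] at h1
  have h2 : ‖y - w‖ = 0 := by nlinarith [norm_nonneg (y - w)]
  exact (sub_eq_zero.1 (norm_eq_zero.1 h2)).symm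

/-- Monotonicity extends from a subset on whose closure the map is continuous. -/
theorem inner_sub_nonneg_of_dense {G : Set E} (hGK : G ⊆ K) (hKG : K ⊆ closure G)
    (hR : ContinuousOn R K)
    (hmono : ∀ z ∈ G, ∀ w ∈ G, 0 ≤ inner ℝ (R z - R w) (z - w)) :
    ∀ z ∈ K, ∀ w ∈ K, 0 ≤ inner ℝ (R z - R w) (z - w) := by
  intro z hz w hw
  have hcont : ContinuousOn (fun p : E × E => inner ℝ (R p.1 - R p.2) (p.1 - p.2)) (K ×ˢ K) := by
    have h1 : ContinuousOn (fun p : E × E => R p.1) (K ×ˢ K) :=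
      hR.comp continuousOn_fst fun p hp => hp.1
    have h2 : ContinuousOn (fun p : E × E => R p.2) (K ×ˢ K) :=
      hR.comp continuousOn_snd fun p hp => hp.2
    exact (h1.sub h2).inner (𝕜 := ℝ) (continuousOn_fst.sub continuousOn_snd)
  have hmem : (z, w) ∈ closure (G ×ˢ G) := by
    rw [closure_prod_eq]; exact ⟨hKG hz, hKG hw⟩
  have := ((hcont (z, w) ⟨hz, hw⟩).mono (prod_mono hGK hGK)).mem_closure hmem
    (t := Ici 0) fun p hp => hmono _ hp.1 _ hp.2
  simpa using this

end

/-! ### Superlevel sets of a density -/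

section
open Filter Topology

variable {α : Type*} [MeasurableSpace α] {m : Measure α} {f : α → ℝ≥0∞} {c : ℝ≥0∞}

theorem mul_measure_le_withDensity {E : Set α} (hE : MeasurableSet E) (h : ∀ y ∈ E, c ≤ f y) :
    c * m E ≤ m.withDensity f E := by
  rw [withDensity_apply _ hE, ← setLIntegral_const]
  exact setLIntegral_mono' hE h

theorem withDensity_le_mul_measure {E : Set α} (hE : MeasurableSet E) (h : ∀ y ∈ E, f y ≤ c) :
    m.withDensity f E ≤ c * m E := by
  rw [withDensity_apply _ hE, ← setLIntegral_const]
  exact setLIntegral_mono' hE h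

/-- The Neyman–Pearson argument: trading mass inside a superlevel set of the density for mass
outside of it costs volume. -/
theorem measure_superlevel_le_of_withDensity_le [IsFiniteMeasure (m.withDensity f)]
    (hC : MeasurableSet {y | c ≤ f y}) (hc0 : c ≠ 0) (hc : c ≠ ∞) {A : Set α}
    (hA : MeasurableSet A) (h : m.withDensity f {y | c ≤ f y} ≤ m.withDensity f A) :
    m {y | c ≤ f y} ≤ m A := by
  set C := {y | c ≤ f y}
  have h1 : m.withDensity f (C \ A) ≤ m.withDensity f (A \ C) := by
    rw [← measure_inter_add_sdiff C hA, ← measure_inter_add_sdiff A hC, inter_comm A C] at h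
    exact (ENNReal.add_le_add_iff_left (measure_ne_top _ _)).1 h
  have h2 : c * m (C \ A) ≤ c * m (A \ C) :=
    (mul_measure_le_withDensity (hC.diff hA) fun y hy => hy.1).trans <| h1.trans <|
      withDensity_le_mul_measure (hA.diff hC) fun y hy => (not_le.1 hy.2).le
  rw [ENNReal.mul_le_mul_iff_right hc0 hc] at h2
  rw [← measure_inter_add_sdiff C hA, ← measure_inter_add_sdiff A hC, inter_comm A C]
  gcongr

/-- The supremum of the thresholds whose superlevel sets have mass at least `β` is attained, by
continuity from above. -/
theorem isGreatest_sSup_superlevel (ν : Measure α) [IsFiniteMeasure ν] (hf : Measurable f)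
    {β : ℝ≥0∞} (hβ : β ≤ ν univ) :
    IsGreatest {s : ℝ≥0∞ | β ≤ ν {y | s ≤ f y}} (sSup {s : ℝ≥0∞ | β ≤ ν {y | s ≤ f y}}) := by
  set S := {s : ℝ≥0∞ | β ≤ ν {y | s ≤ f y}}
  refine ⟨?_, fun s hs => le_sSup hs⟩
  have hne : S.Nonempty := ⟨0, by simpa [S] using hβ⟩
  obtain ⟨u, hu, hlim, huS⟩ := exists_seq_tendsto_sSup hne (OrderTop.bddAbove S)
  have hset : {y | sSup S ≤ f y} = ⋂ n, {y | u n ≤ f y} := by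
    ext y
    simp only [mem_ofPred_eq, mem_iInter]
    exact ⟨fun h n => (le_sSup (huS n)).trans h, fun h => le_of_tendsto' hlim h⟩
  show β ≤ ν {y | sSup S ≤ f y}
  rw [hset]
  refine ge_of_tendsto' (tendsto_measure_iInter_atTop
    (fun n => (measurableSet_le measurable_const hf).nullMeasurableSet)
    (fun i j hij y hy => (hu hij).trans hy) ⟨0, measure_ne_top _ _⟩) huS

/-- A superlevel set of mass exactly `β` is, up to a null set, the superlevel set of the largest
admissible threshold, even if the threshold `c` itself is not the largest one because the density
jumps over an interval of values. -/
theorem exists_isGreatest_superlevel_ae_eq [IsFiniteMeasure (m.withDensity f)]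
    (hf : Measurable f) (hc0 : c ≠ 0) {β : ℝ≥0∞} (hβ : m.withDensity f {y | c ≤ f y} = β) :
    ∃ t, IsGreatest {s : ℝ≥0∞ | β ≤ m.withDensity f {y | s ≤ f y}} t ∧
      ({y | c ≤ f y} : Set α) =ᵐ[m] {y | t ≤ f y} := by
  have hmeas : ∀ s, MeasurableSet {y | s ≤ f y} := fun s => measurableSet_le measurable_const hf
  have ht := isGreatest_sSup_superlevel (m.withDensity f) hf
    (hβ ▸ measure_mono (subset_univ _) : β ≤ m.withDensity f univ)
  refine ⟨_, ht, ?_⟩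
  set t := sSup {s : ℝ≥0∞ | β ≤ m.withDensity f {y | s ≤ f y}}
  have hct : c ≤ t := ht.2 hβ.ge
  have hsub : {y | t ≤ f y} ⊆ {y | c ≤ f y} := fun y hy => hct.trans hy
  have h0 : m.withDensity f ({y | c ≤ f y} \ {y | t ≤ f y}) = 0 := by
    rw [measure_sdiff hsub (hmeas t).nullMeasurableSet (measure_ne_top _ _), tsub_eq_zero_iff_le,
      hβ]
    exact ht.1
  have h1 : c * m ({y | c ≤ f y} \ {y | t ≤ f y}) = 0 :=
    le_antisymm ((mul_measure_le_withDensity ((hmeas c).diff (hmeas t))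
      fun y hy => hy.1).trans h0.le) zero_le
  refine (ae_le_set.2 ?_).antisymm hsub.eventuallyLE
  exact (mul_eq_zero.1 h1).resolve_left hc0

end

/-! ### Radii of balls of prescribed mass -/

section
open Filter Topology Metric

theorem continuous_cdf (ρ : Measure ℝ) [IsProbabilityMeasure ρ] [NullSingletonClass ρ] :
    Continuous (cdf ρ) := by
  refine continuous_iff_continuousAt.2 fun x => ?_
  rw [(monotone_cdf ρ).continuousAt_iff_leftLim_eq_rightLim, StieltjesFunction.rightLim_eq]
  have h := (cdf ρ).measure_singleton x
  rw [measure_cdf, measure_singleton, eq_comm, ENNReal.ofReal_eq_zero, sub_nonpos] at h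
  exact le_antisymm ((monotone_cdf ρ).leftLim_le le_rfl) h

theorem ordConnected_nnnorm_image {F : Type*} [NormedAddCommGroup F] [NormedSpace ℝ F]
    {S : Set F} (hS : Convex ℝ S) :
    ((fun u => ‖u‖₊) '' S).OrdConnected :=
  (hS.isPreconnected.image _ continuous_nnnorm.continuousOn).ordConnected

theorem exists_mem_support_of_measure_ne_zero {F : Type*} [TopologicalSpace F]
    [HereditarilyLindelofSpace F] [MeasurableSpace F] {μ : Measure F} {A : Set F} (h : μ A ≠ 0) :
    ∃ u ∈ μ.support, u ∈ A :=
  let ⟨u, hu⟩ := Measure.nonempty_inter_support_of_pos (pos_iff_ne_zero.2 h)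
  ⟨u, hu.2, hu.1⟩

variable {E : Type*} [NormedAddCommGroup E] [NormedSpace ℝ E] [MeasurableSpace E] [BorelSpace E]
  [FiniteDimensional ℝ E] {μ : Measure E} [IsProbabilityMeasure μ]

theorem exists_mem_support_lt_norm {r : ℝ} (h : μ (closedBall 0 r) < 1) :
    ∃ u ∈ μ.support, r < ‖u‖ := by
  obtain ⟨u, hu, h'⟩ := exists_mem_support_of_measure_ne_zero (μ := μ) (A := (closedBall 0 r)ᶜ)
    (by rw [prob_compl_eq_one_sub measurableSet_closedBall]; exact (tsub_pos_of_lt h).ne')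
  exact ⟨u, hu, by simpa using h'⟩

/-- The radius of a centred ball that carries a proper part of the mass is the norm of a point of
the support. -/
theorem mem_nnnorm_image_support (hS : Convex ℝ μ.support) {r : ℝ≥0}
    (h0 : μ (closedBall 0 r) ≠ 0) (h1 : μ (closedBall 0 r) < 1) :
    r ∈ (fun u => ‖u‖₊) '' μ.support := by
  obtain ⟨u, hu, hur⟩ := exists_mem_support_of_measure_ne_zero h0
  obtain ⟨v, hv, hvr⟩ := exists_mem_support_lt_norm h1
  refine (ordConnected_nnnorm_image hS).out (mem_image_of_mem _ hu) (mem_image_of_mem _ hv)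
    ⟨?_, ?_⟩
  · exact_mod_cast (mem_closedBall_zero_iff.1 hur)
  · exact_mod_cast hvr.le

/-- The mass of centred balls is the distribution function of the norm, which has no atoms because
spheres are null. -/
theorem exists_closedBall_measure_eq [Nontrivial E] {vol : Measure E} [vol.IsAddHaarMeasure]
    (hμ : μ ≪ vol) {β : ℝ} (h0 : 0 < β) (h1 : β < 1) :
    ∃ r : ℝ, 0 < r ∧ μ (closedBall 0 r) = ENNReal.ofReal β := by
  have hmeas : Measurable (norm : E → ℝ) := measurable_norm
  have hpre : ∀ r : ℝ, norm ⁻¹' Iic r = closedBall (0 : E) r := fun r => by ext; simp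
  have hρ : IsProbabilityMeasure (μ.map norm) := Measure.isProbabilityMeasure_map hmeas.aemeasurable
  have hatom : NullSingletonClass (μ.map norm) := ⟨fun r => by
    rw [Measure.map_apply hmeas (measurableSet_singleton r)]
    have : norm ⁻¹' {r} = sphere (0 : E) r := by ext; simp
    rw [this]
    exact hμ (Measure.addHaar_sphere vol 0 r)⟩
  have hcdf : ∀ r, ENNReal.ofReal (cdf (μ.map norm) r) = μ (closedBall 0 r) := fun r => by
    rw [ofReal_cdf, Measure.map_apply hmeas measurableSet_Iic, hpre]
  obtain ⟨r, hr⟩ : β ∈ range (cdf (μ.map norm)) := by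
    refine mem_range_of_exists_le_of_exists_ge (continuous_cdf _) ?_ ?_
    · exact ((tendsto_cdf_atBot _).eventually (ge_mem_nhds h0)).exists
    · exact ((tendsto_cdf_atTop _).eventually (le_mem_nhds h1)).exists
  have hr' : μ (closedBall 0 r) = ENNReal.ofReal β := by rw [← hcdf, hr]
  refine ⟨r, not_le.1 fun hle => ?_, hr'⟩
  have : μ (closedBall 0 r) = 0 := by
    refine hμ (measure_mono_null (closedBall_subset_closedBall hle) ?_)
    rw [closedBall_zero]
    exact measure_singleton 0
  rw [hr'] at this
  exact (ENNReal.ofReal_pos.2 h0).ne' this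

/-- Between two radii of balls with the same mass there would be an open shell without mass, which
the connected support would have to cross. -/
theorem closedBall_radius_unique (hS : Convex ℝ μ.support) {r s : ℝ}
    (hrs : μ (closedBall 0 r) = μ (closedBall 0 s)) (h0 : μ (closedBall 0 r) ≠ 0)
    (h1 : μ (closedBall 0 r) < 1) : r = s := by
  wlog hlt : r < s generalizing r s
  · rcases (not_lt.1 hlt).eq_or_lt with h | h
    · exact h.symm
    · exact (this hrs.symm (hrs ▸ h0) (hrs ▸ h1) h).symm
  exfalso
  obtain ⟨u, hu, hur⟩ := exists_mem_support_of_measure_ne_zero h0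
  obtain ⟨v, hv, hvs⟩ := exists_mem_support_lt_norm (hrs ▸ h1)
  have hur : ‖u‖ ≤ r := by simpa using hur
  have hr : 0 ≤ r := (norm_nonneg u).trans hur
  obtain ⟨w, hw, hws⟩ : ((r + s) / 2).toNNReal ∈ (fun u => ‖u‖₊) '' μ.support := by
    refine (ordConnected_nnnorm_image hS).out (mem_image_of_mem _ hu) (mem_image_of_mem _ hv)
      ⟨?_, ?_⟩
    · rw [← NNReal.coe_le_coe, Real.coe_toNNReal _ (by linarith), coe_nnnorm]; linarith
    · rw [← NNReal.coe_le_coe, Real.coe_toNNReal _ (by linarith), coe_nnnorm]; linarith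
  have hw' : ‖w‖ = (r + s) / 2 := by
    rw [← coe_nnnorm]
    exact (congrArg NNReal.toReal hws).trans (Real.coe_toNNReal _ (by linarith))
  have hopen : IsOpen (ball (0 : E) s \ closedBall 0 r) := isOpen_ball.sdiff isClosed_closedBall
  have hpos := (Measure.mem_support_iff_forall w).1 hw _ (hopen.mem_nhds
    ⟨by rw [mem_ball_zero_iff]; linarith, by rw [mem_closedBall_zero_iff]; linarith⟩)
  refine hpos.ne' (measure_mono_null (sdiff_subset_sdiff_left ball_subset_closedBall) ?_)
  rw [measure_sdiff (closedBall_subset_closedBall hlt.le)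
    measurableSet_closedBall.nullMeasurableSet (measure_ne_top _ _), hrs, tsub_self]

end

/-! ### The density of the conditional law -/

section
open Filter Topology Metric

variable {d : ℕ} {μ ν : Measure (EuclideanSpace ℝ (Fin d))} {φ j : ℝ≥0 → ℝ}
  {Q R : EuclideanSpace ℝ (Fin d) → EuclideanSpace ℝ (Fin d)}

theorem IsRadialReference.absolutelyContinuous (hμ : IsRadialReference μ φ) : μ ≪ volume := by
  rw [hμ.eq_withDensity]
  exact (withDensity_absolutelyContinuous _ _).trans Measure.restrict_le_self.absolutelyContinuous

/-- The radial density is positive on the support, so Lebesgue measure restricted to the support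
is absolutely continuous with respect to the reference law. -/
theorem IsRadialReference.volume_eq_zero (hμ : IsRadialReference μ φ)
    {A : Set (EuclideanSpace ℝ (Fin d))} (hA : A ⊆ μ.support) (h0 : μ A = 0) : volume A = 0 := by
  have hφ : Measurable fun u : EuclideanSpace ℝ (Fin d) => ENNReal.ofReal (φ ‖u‖₊) :=
    (hμ.measurable.comp measurable_nnnorm).ennreal_ofReal
  have hac : volume.restrict μ.support ≪ μ := by
    have := withDensity_absolutelyContinuous' (μ := volume.restrict μ.support) hφ.aemeasurable
      (.of_forall fun u => (ENNReal.ofReal_pos.2 (hμ.pos _)).ne')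
    rwa [← hμ.eq_withDensity] at this
  have := hac h0
  rwa [Measure.restrict_eq_self _ hA] at this

theorem IsRadialReference.apply_eq_setLIntegral (hμ : IsRadialReference μ φ)
    {A : Set (EuclideanSpace ℝ (Fin d))} (hA : A ⊆ μ.support) (hm : MeasurableSet A) :
    μ A = ∫⁻ u in A, ENNReal.ofReal (φ ‖u‖₊) := by
  conv_lhs => rw [hμ.eq_withDensity]
  rw [withDensity_apply _ hm, Measure.restrict_restrict hm, inter_eq_self_of_subset_left hA]

theorem IsVectorRank.map_eq (hQ : IsVectorQuantile μ ν Q) (hR : IsVectorRank μ ν Q R) :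
    ν.map R = μ := by
  rw [← hQ.map_eq, Measure.map_map hR.measurable hQ.measurable]
  exact (Measure.map_congr hR.left_inv).trans Measure.map_id

/-- Outside a null set, `R` inverts `Q`, and it is monotone there because `Q` is the gradient of a
convex function. -/
theorem IsVectorRank.exists_measurableSet_monotone (hμ : IsRadialReference μ φ)
    (hQ : IsVectorQuantile μ ν Q) (hR : IsVectorRank μ ν Q R) :
    ∃ G, MeasurableSet G ∧ G ⊆ ν.support ∧ ν Gᶜ = 0 ∧ (∀ y ∈ G, Q (R y) = y) ∧
      ∀ z ∈ G, ∀ w ∈ G, 0 ≤ inner ℝ (R z - R w) (z - w) := by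
  obtain ⟨Φ, hΦ, hgrad⟩ := hQ.gradient_convex
  have hint : ∀ᵐ u ∂μ, u ∈ interior μ.support := by
    have h1 : ∀ᵐ u ∂μ, u ∉ frontier μ.support := measure_eq_zero_iff_ae_notMem.1
      (hμ.absolutelyContinuous (hμ.convex_support.addHaar_frontier volume))
    filter_upwards [h1, Measure.support_mem_ae (μ := μ)] with u hu hu'
    by_contra hi
    exact hu ⟨subset_closure hu', hi⟩
  obtain ⟨U, hU, hUm, hUgrad⟩ := (hint.and hgrad).exists_measurable_mem
  have hQRm : MeasurableSet {y | Q (R y) = y} :=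
    measurableSet_eq_fun (hQ.measurable.comp hR.measurable) measurable_id
  set G := ν.support ∩ (R ⁻¹' U ∩ {y | Q (R y) = y})
  have hGm : MeasurableSet G :=
    Measure.isClosed_support.measurableSet.inter ((hR.measurable hUm).inter hQRm)
  refine ⟨G, hGm, inter_subset_left, ?_, fun y hy => hy.2.2, fun z hz w hw => ?_⟩
  · have hsupp : ∀ᵐ u ∂μ, Q u ∈ ν.support := by
      have : ∀ᵐ y ∂μ.map Q, y ∈ ν.support := by rw [hQ.map_eq]; exact Measure.support_mem_ae
      exact ae_of_ae_map hQ.measurable.aemeasurable this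
    have hG : ∀ᵐ u ∂μ, Q u ∈ G := by
      filter_upwards [hsupp, hR.left_inv, hU] with u h1 h2 h3
      exact ⟨h1, by rwa [mem_preimage, h2], congrArg Q h2⟩
    have := (ae_map_iff hQ.measurable.aemeasurable hGm).2 hG
    rw [hQ.map_eq] at this
    exact mem_ae_iff.1 this
  · have hz' := hUgrad _ hz.2.1
    have hw' := hUgrad _ hw.2.1
    have := hΦ.inner_gradient_sub_nonneg hz'.1 hw'.1 hz'.2 hw'.2
    rwa [hz.2.2, hw.2.2, real_inner_comm] at this

/-- The set on which `R` inverts `Q` is dense in the support, and `R` is continuous there. -/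
theorem HasRadialJacobian.monotone (hμ : IsRadialReference μ φ)
    (hQ : IsVectorQuantile μ ν Q) (hR : IsVectorRank μ ν Q R) (hj : HasRadialJacobian ν R j) :
    ∀ z ∈ ν.support, ∀ w ∈ ν.support, 0 ≤ inner ℝ (R z - R w) (z - w) := by
  obtain ⟨G, hGm, hGK, hG0, -, hmono⟩ := hR.exists_measurableSet_monotone hμ hQ
  refine inner_sub_nonneg_of_dense hGK ?_ (fun y hy => ?_) hmono
  · exact Measure.support_subset_of_isClosed isClosed_closure
      (mem_of_superset (mem_ae_iff.2 hG0) subset_closure)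
  · obtain ⟨D, hD, -⟩ := hj y hy
    exact hD.continuousWithinAt

/-- Almost every point of a measurable set is a density point, hence has all tangent directions. -/
theorem exists_measurableSet_posTangentConeAt_eq_univ {K : Set (EuclideanSpace ℝ (Fin d))}
    (hK : MeasurableSet K) :
    ∃ N ⊆ K, MeasurableSet N ∧ volume (K \ N) = 0 ∧ ∀ y ∈ N, posTangentConeAt K y = univ := by
  have h := Besicovitch.ae_tendsto_measure_inter_div
    (volume : Measure (EuclideanSpace ℝ (Fin d))) K
  have h' : ∀ᵐ y ∂volume.restrict K, posTangentConeAt K y = univ :=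
    h.mono fun y hy => posTangentConeAt_eq_univ_of_density_one volume hy
  rw [ae_restrict_iff' hK] at h'
  obtain ⟨B, hBsub, hBm, hB0⟩ := exists_measurable_superset_of_null (ae_iff.1 h')
  refine ⟨K \ B, sdiff_subset, hK.diff hBm, ?_, fun y hy => ?_⟩
  · rw [sdiff_sdiff_right_self]
    exact measure_mono_null inter_subset_right hB0
  · by_contra hne
    exact hy.2 (hBsub fun himp => hne (himp hy.1))

/-- The change of variables formula for the rank map. The set `T` of density points of the support
at which the Jacobian does not vanish is mapped injectively, by monotonicity. The part of `T` on
which `R` fails to invert `Q` is mapped into a null set, so it is itself null: no Lebesgue mass of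
the support escapes the density. -/
theorem HasRadialJacobian.eq_withDensity [IsProbabilityMeasure μ] [IsFiniteMeasure ν] (hd : 0 < d)
    (hac : ν ≪ volume)
    (hμ : IsRadialReference μ φ) (hQ : IsVectorQuantile μ ν Q) (hR : IsVectorRank μ ν Q R)
    (hj : HasRadialJacobian ν R j)
    (hanti : StrictAntiOn (fun r : ℝ≥0 => φ r * j r) ((fun u => ‖u‖₊) '' μ.support)) :
    AEMeasurable (ν.support.indicator fun y => ENNReal.ofReal (φ ‖R y‖₊ * j ‖R y‖₊)) volume ∧
    ν = volume.withDensity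
      (ν.support.indicator fun y => ENNReal.ofReal (φ ‖R y‖₊ * j ‖R y‖₊)) ∧
    ∀ᵐ y ∂ν, 0 ≤ j ‖R y‖₊ := by
  have : Nontrivial (EuclideanSpace ℝ (Fin d)) := by
    have : Nonempty (Fin d) := ⟨⟨0, hd⟩⟩
    infer_instance
  have hmono := hj.monotone hμ hQ hR
  obtain ⟨G, hGm, hGK, hG0, hQR, -⟩ := hR.exists_measurableSet_monotone hμ hQ
  obtain ⟨N, hNK, hNm, hN0, hNcone⟩ := exists_measurableSet_posTangentConeAt_eq_univ
    (Measure.isClosed_support (μ := ν)).measurableSet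
  choose! D hD hdet using hj
  have hDnn : ∀ y ∈ N, 0 ≤ j ‖R y‖₊ := fun y hy => by
    rw [← hdet y (hNK hy)]
    exact (D y).det_nonneg_of_inner_nonneg
      (inner_nonneg_of_hasFDerivWithinAt_of_monotone (hD y (hNK hy)) (hNK hy) (hNcone y hy) hmono)
  have hNν : ν Nᶜ = 0 := by
    refine measure_mono_null (t := ν.supportᶜ ∪ ν.support \ N) (fun y hy => ?_)
      (measure_union_null Measure.measure_compl_support (hac hN0))
    by_cases h : y ∈ ν.support
    · exact Or.inr ⟨h, hy⟩
    · exact Or.inl h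
  -- Strict monotonicity lets the Jacobian vanish for at most one radius.
  set Z : Set ℝ≥0 := {ρ | ρ ∈ (fun u => ‖u‖₊) '' μ.support ∧ φ ρ * j ρ = 0}
  have hZ : Z.Subsingleton := fun a ha b hb => hanti.injOn ha.1 hb.1 (ha.2.trans hb.2.symm)
  set W := (fun y => ‖R y‖₊) ⁻¹' Z
  have hWm : MeasurableSet W := hR.measurable.nnnorm hZ.measurableSet
  have hW0 : ν W = 0 := by
    have h1 : ν W = μ ((fun u => ‖u‖₊) ⁻¹' Z) := by
      rw [← hR.map_eq hQ, Measure.map_apply hR.measurable (measurable_nnnorm hZ.measurableSet)]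
      rfl
    rw [h1]
    rcases hZ.eq_empty_or_singleton with h | ⟨ρ, h⟩
    · simp [h]
    · rw [h]
      have h2 : (fun u : EuclideanSpace ℝ (Fin d) => ‖u‖₊) ⁻¹' {ρ} = sphere 0 (ρ : ℝ) := by
        ext u; simp [← NNReal.coe_inj]
      rw [h2]
      exact hμ.absolutelyContinuous (Measure.addHaar_sphere volume 0 _)
  set T := N \ W
  have hTm : MeasurableSet T := hNm.diff hWm
  have hTK : T ⊆ ν.support := sdiff_subset.trans hNK
  have hTj : ∀ y ∈ T, (D y).det ≠ 0 := fun y hy h0 => hy.2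
    ⟨mem_image_of_mem _ (hR.mapsTo (hTK hy)), by rw [← hdet y (hTK hy), h0, mul_zero]⟩
  have hTν : ν Tᶜ = 0 := by
    refine measure_mono_null (t := Nᶜ ∪ W) (fun y hy => ?_) (measure_union_null hNν hW0)
    by_contra h
    simp only [mem_union, not_or, mem_compl_iff, not_not] at h
    exact hy ⟨h.1, h.2⟩
  have hinj : ∀ y ∈ T, ∀ w ∈ ν.support, R w = R y → w = y := fun y hy w hw h =>
    eq_of_hasFDerivWithinAt_of_monotone (hD y (hTK hy)) (hNcone y hy.1) hmono (hTj y hy) hw h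
  have hDT : ∀ {A}, A ⊆ T → ∀ y ∈ A, HasFDerivWithinAt R (D y) A y := fun hA y hy =>
    (hD y (hTK (hA hy))).mono (hA.trans hTK)
  have hinjOn : ∀ {A}, A ⊆ T → InjOn R A := fun hA y hy w hw h =>
    hinj w (hA hw) y (hTK (hA hy)) h
  have himage : ∀ {A}, A ⊆ T → R '' A ⊆ μ.support := fun hA => by
    rintro _ ⟨y, hy, rfl⟩
    exact hR.mapsTo (hTK (hA hy))
  -- By injectivity `R '' (T \ G)` misses `R '' G`, which has full reference measure.
  have hTG : volume (T \ G) = 0 := by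
    have hμ0 : μ (R '' (T \ G)) = 0 := by
      have hQG : ∀ᵐ u ∂μ, Q u ∈ G := by
        have : ∀ᵐ y ∂μ.map Q, y ∈ G := by rw [hQ.map_eq]; exact mem_ae_iff.2 hG0
        exact ae_of_ae_map hQ.measurable.aemeasurable this
      refine measure_eq_zero_iff_ae_notMem.2 ?_
      filter_upwards [hQG, hR.left_inv] with u hu hRQ
      rintro ⟨y, hy, rfl⟩
      exact hy.2 (hinj y hy.1 _ (hGK hu) hRQ ▸ hu)
    have hvol := hμ.volume_eq_zero (himage sdiff_subset) hμ0
    rw [← lintegral_abs_det_fderiv_eq_addHaar_image volume (hTm.diff hGm) (hDT sdiff_subset)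
      (hinjOn sdiff_subset), lintegral_eq_zero_iff'
      (aemeasurable_ofReal_abs_det_fderivWithin volume (hTm.diff hGm) (hDT sdiff_subset))] at hvol
    have h1 : ∀ᵐ y ∂volume, y ∈ T \ G → ENNReal.ofReal |(D y).det| = 0 :=
      (ae_restrict_iff' (hTm.diff hGm)).1 hvol
    refine measure_eq_zero_iff_ae_notMem.2 (h1.mono fun y hy hyT => ?_)
    have := ENNReal.ofReal_eq_zero.1 (hy hyT)
    exact (abs_pos.2 (hTj y hyT.1)).not_ge this
  set g : EuclideanSpace ℝ (Fin d) → ℝ≥0∞ := fun y => ENNReal.ofReal (φ ‖R y‖₊ * j ‖R y‖₊)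
  have hg : ∀ y ∈ T, ENNReal.ofReal |(D y).det| * ENNReal.ofReal (φ ‖R y‖₊) = g y := fun y hy => by
    rw [hdet y (hTK hy), abs_of_nonneg (hDnn y hy.1), ← ENNReal.ofReal_mul (hDnn y hy.1), mul_comm]
  have hae : ν.support.indicator g =ᵐ[volume] T.indicator g := by
    have h1 := measure_eq_zero_iff_ae_notMem.1 hN0
    filter_upwards [h1] with y hy
    -- On `W` the first indicator also vanishes, because the product `φ * j` does.
    by_cases hyK : y ∈ ν.support
    · have hyN : y ∈ N := by by_contra h; exact hy ⟨hyK, h⟩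
      by_cases hyW : y ∈ W
      · rw [indicator_of_mem hyK, indicator_of_notMem fun h => h.2 hyW]
        simp only [g]
        rw [hyW.2, ENNReal.ofReal_zero]
      · rw [indicator_of_mem hyK, indicator_of_mem (show y ∈ T from ⟨hyN, hyW⟩)]
    · rw [indicator_of_notMem hyK, indicator_of_notMem fun h => hyK (hTK h)]
  refine ⟨AEMeasurable.congr ?_ hae.symm, ?_, ?_⟩
  · rw [aemeasurable_indicator_iff hTm]
    have h1 := aemeasurable_ofReal_abs_det_fderivWithin volume hTm (hDT subset_rfl)
    have h2 : Measurable fun y => ENNReal.ofReal (φ ‖R y‖₊) :=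
      (hμ.measurable.comp hR.measurable.nnnorm).ennreal_ofReal
    exact (h1.mul h2.aemeasurable).congr ((ae_restrict_iff' hTm).2 (.of_forall hg))
  · rw [withDensity_congr_ae hae]
    ext E hE
    set A := E ∩ (T ∩ G)
    have hAm : MeasurableSet A := hE.inter (hTm.inter hGm)
    have hAT : A ⊆ T := inter_subset_right.trans inter_subset_left
    have hRA : MeasurableSet (R '' A) :=
      measurable_image_of_fderivWithin hAm (hDT hAT) (hinjOn hAT)
    have hTGν : ν (T ∩ G)ᶜ = 0 := by rw [compl_inter]; exact measure_union_null hTν hG0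
    calc ν E = ν A := (measure_inter_conull hTGν).symm
      _ = ν (R ⁻¹' (R '' A)) := by
        -- Points of `G` with the same image under `R` coincide, since `Q` inverts `R` on `G`.
        refine (measure_mono (subset_preimage_image R A)).antisymm ?_
        rw [← measure_inter_conull hG0 (s := R ⁻¹' (R '' A))]
        refine measure_mono ?_
        rintro y ⟨⟨w, hw, hwy⟩, hyG⟩
        rwa [← hQR y hyG, ← hwy, hQR w hw.2.2]
      _ = μ (R '' A) := by rw [← Measure.map_apply hR.measurable hRA, hR.map_eq hQ]
      _ = ∫⁻ y in A, g y := by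
        rw [hμ.apply_eq_setLIntegral (himage hAT) hRA,
          lintegral_image_eq_lintegral_abs_det_fderiv_mul volume hAm (hDT hAT) (hinjOn hAT)]
        exact setLIntegral_congr_fun hAm fun y hy => hg y (hAT hy)
      _ = ∫⁻ y in E ∩ T, g y := by
        refine setLIntegral_congr ?_
        have hsub : A ⊆ E ∩ T := inter_subset_inter_right _ inter_subset_left
        refine hsub.eventuallyLE.antisymm (ae_le_set.2 ?_)
        refine measure_mono_null (t := T \ G)
          (fun y hy => ⟨hy.1.2, fun h => hy.2 ⟨hy.1.1, hy.1.2, h⟩⟩) hTG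
      _ = volume.withDensity (T.indicator g) E := by
        rw [withDensity_apply _ hE, setLIntegral_indicator hTm, inter_comm]
  · exact mem_of_superset (mem_ae_iff.2 hNν) hDnn

end

/-! ### Optimality of the pullback ball -/

theorem mainTheorem1
    {Ω : Type*} [MeasurableSpace Ω] (P : Measure Ω) [IsProbabilityMeasure P]
    {d dx : ℕ} (hd : 0 < d)
    -- the response `Y`, the covariate `X`, and a version `κ` of the conditional law of `Y` given `X`
    (Y : Ω → EuclideanSpace ℝ (Fin d)) (X : Ω → EuclideanSpace ℝ (Fin dx))
    (hY : Measurable Y) (hX : Measurable X)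
    (κ : Kernel (EuclideanSpace ℝ (Fin dx)) (EuclideanSpace ℝ (Fin d))) [IsMarkovKernel κ]
    (hκ : P.map (fun ω => (X ω, Y ω)) = (P.map X) ⊗ₘ κ)
    (x : EuclideanSpace ℝ (Fin dx)) (hx : x ∈ (P.map X).support)
    (hac : κ x ≪ volume)
    -- the reference law, with radial density on its convex support
    (μ : Measure (EuclideanSpace ℝ (Fin d))) [IsProbabilityMeasure μ]
    (φ : ℝ≥0 → ℝ) (hμ : IsRadialReference μ φ)
    -- the conditional vector quantile and the conditional rank map
    (Q R : EuclideanSpace ℝ (Fin d) → EuclideanSpace ℝ (Fin dx) → EuclideanSpace ℝ (Fin d))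
    (hQ : IsVectorQuantile μ (κ x) (fun u => Q u x))
    (hR : IsVectorRank μ (κ x) (fun u => Q u x) (fun y => R y x))
    (j : ℝ≥0 → ℝ) (hj : HasRadialJacobian (κ x) (fun y => R y x) j)
    (hanti : StrictAntiOn (fun r : ℝ≥0 => φ r * j r) ((fun u => ‖u‖₊) '' μ.support))
    (α : ℝ) (hα0 : 0 < α) (hα1 : α < 1) :
    (∃! r : ℝ, 0 < r ∧ μ (Metric.closedBall 0 r) = ENNReal.ofReal (1 - α)) ∧
    ∀ r : ℝ, 0 < r → μ (Metric.closedBall 0 r) = ENNReal.ofReal (1 - α) →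
      MeasurableSet (pullbackBall (κ x) (fun y => R y x) r) ∧
      κ x (pullbackBall (κ x) (fun y => R y x) r) = ENNReal.ofReal (1 - α) ∧
      (∀ A : Set (EuclideanSpace ℝ (Fin d)), MeasurableSet A →
        ENNReal.ofReal (1 - α) ≤ κ x A →
        volume (pullbackBall (κ x) (fun y => R y x) r) ≤ volume A) ∧
      IsHPDRegion (κ x) (1 - α) (pullbackBall (κ x) (fun y => R y x) r) := by
  have : Nontrivial (EuclideanSpace ℝ (Fin d)) := by
    have : Nonempty (Fin d) := ⟨⟨0, hd⟩⟩
    infer_instance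
  have hβ0 : ENNReal.ofReal (1 - α) ≠ 0 := (ENNReal.ofReal_pos.2 (by linarith)).ne'
  have hβ1 : ENNReal.ofReal (1 - α) < 1 := by
    rw [← ENNReal.ofReal_one]
    exact (ENNReal.ofReal_lt_ofReal_iff one_pos).2 (by linarith)
  refine ⟨?_, fun r hr hμr => ?_⟩
  · obtain ⟨r, hr, hμr⟩ := exists_closedBall_measure_eq hμ.absolutelyContinuous
      (show 0 < 1 - α by linarith) (by linarith)
    exact ⟨r, ⟨hr, hμr⟩, fun s hs => closedBall_radius_unique hμ.convex_support
      (hs.2.trans hμr.symm) (hs.2 ▸ hβ0) (hs.2 ▸ hβ1)⟩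
  lift r to ℝ≥0 using hr.le
  set ν := κ x
  set T : EuclideanSpace ℝ (Fin d) → EuclideanSpace ℝ (Fin d) := fun y => R y x
  obtain ⟨hgm, hν, hjnn⟩ := hj.eq_withDensity hd hac hμ hQ hR hanti
  set g : EuclideanSpace ℝ (Fin d) → ℝ≥0∞ :=
    ν.support.indicator fun y => ENNReal.ofReal (φ ‖T y‖₊ * j ‖T y‖₊)
  have hmap : ν.map T = μ := hR.map_eq hQ
  have hCm : MeasurableSet (pullbackBall ν T r) :=
    Measure.isClosed_support.measurableSet.inter
      (measurableSet_le hR.measurable.norm measurable_const)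
  have hνball : ν (T ⁻¹' Metric.closedBall 0 r) = ENNReal.ofReal (1 - α) := by
    rw [← Measure.map_apply hR.measurable measurableSet_closedBall, hmap, hμr]
  have hνC : ν (pullbackBall ν T r) = ENNReal.ofReal (1 - α) := by
    rw [← hνball, ← measure_inter_conull (s := T ⁻¹' Metric.closedBall 0 (r : ℝ))
      (Measure.measure_compl_support (μ := ν))]
    congr 1
    ext y
    simp [pullbackBall, and_comm]
  have hradii : ∀ y ∈ ν.support, ‖T y‖₊ ∈ (fun u => ‖u‖₊) '' μ.support := fun y hy =>
    mem_image_of_mem _ (hR.mapsTo hy)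
  have hrr : r ∈ (fun u => ‖u‖₊) '' μ.support :=
    mem_nnnorm_image_support hμ.convex_support (hμr ▸ hβ0) (hμr ▸ hβ1)
  -- The Jacobian is nonnegative at some radius beyond `r`, so `φ * j` is positive at `r`.
  have hpos : 0 < φ r * j r := by
    have h1 : ν (T ⁻¹' Metric.closedBall 0 r)ᶜ ≠ 0 := by
      rw [prob_compl_eq_one_sub (hR.measurable measurableSet_closedBall), hνball]
      exact (tsub_pos_of_lt hβ1).ne'
    obtain ⟨y, hy, hyj, hyK⟩ : ∃ y ∈ (T ⁻¹' Metric.closedBall 0 (r : ℝ))ᶜ,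
        0 ≤ j ‖T y‖₊ ∧ y ∈ ν.support := by
      by_contra! h
      refine h1 (measure_mono_null (fun y hy => ?_)
        (mem_ae_iff.1 (hjnn.and (Measure.support_mem_ae (μ := ν)))))
      exact fun h2 => h y hy h2.1 h2.2
    have hlt : r < ‖T y‖₊ := by
      rw [← NNReal.coe_lt_coe, coe_nnnorm]
      simpa using hy
    exact (mul_nonneg (hμ.pos _).le hyj).trans_lt (hanti hrr (hradii y hyK) hlt)
  set c : ℝ≥0∞ := ENNReal.ofReal (φ r * j r)
  have hc0 : c ≠ 0 := (ENNReal.ofReal_pos.2 hpos).ne'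
  -- Equality holds pointwise: off the support `g` vanishes while `c` does not.
  have hC : pullbackBall ν T r = {y | c ≤ g y} := by
    ext y
    by_cases hy : y ∈ ν.support
    · have h1 : ‖T y‖ ≤ r ↔ ‖T y‖₊ ≤ r := by rw [← NNReal.coe_le_coe, coe_nnnorm]
      have h2 : c ≤ g y ↔ ‖T y‖₊ ≤ r := by
        simp only [c, g, indicator_of_mem hy]
        rw [ENNReal.ofReal_le_ofReal_iff']
        simp only [hpos.not_ge, or_false]
        exact hanti.le_iff_ge hrr (hradii y hy)
      simp only [pullbackBall, mem_ofPred_eq, hy, true_and, h1, h2]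
    · simp [pullbackBall, hy, g, hc0]
  have hfin : ∀ {f}, ν = volume.withDensity f → IsFiniteMeasure (volume.withDensity f) :=
    fun h => h ▸ inferInstanceAs (IsFiniteMeasure (κ x))
  refine ⟨hCm, hνC, fun A hA hνA => ?_, hac, fun f hf hνf => ?_⟩
  · have := hfin hν
    rw [hC] at hCm hνC ⊢
    refine measure_superlevel_le_of_withDensity_le hCm hc0 ENNReal.ofReal_ne_top hA ?_
    rw [← hν, hνC]
    exact hνA
  · have := hfin hνf
    have hνtop : ∫⁻ y, g y ≠ ∞ := by
      rw [← setLIntegral_univ, ← withDensity_apply _ MeasurableSet.univ, ← hν]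
      exact measure_ne_top _ _
    have hfg : g =ᵐ[volume] f :=
      (withDensity_eq_iff hgm hf.aemeasurable hνtop).1 (hν.symm.trans hνf)
    have hCf : pullbackBall ν T r =ᵐ[volume] {y | c ≤ f y} := by
      rw [hC]
      filter_upwards [hfg] with y hy
      simp only [eq_iff_iff]
      change c ≤ g y ↔ c ≤ f y
      rw [hy]
    obtain ⟨t, ht, hct⟩ := exists_isGreatest_superlevel_ae_eq (m := volume) hf hc0
      (β := ENNReal.ofReal (1 - α))
      (by rw [← hνf, ← hνC]; exact (measure_congr (hac.ae_eq hCf)).symm)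
    rw [← hνf] at ht
    exact ⟨t, ht, hCf.trans hct⟩
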